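/- Let $m\in\mathbb N$, and let $\mathcal E_B,\mathcal E_T$ be two single-mode bosonic Gaussian phase-insensitive channels (background and target), with transmissivities $\tau_B,\tau_T\ge 0$ and induced noises $\nu_B\ge|1-\tau_B|/2$, $\nu_T\ge|1-\tau_T|/2$; such a channel acts on the covariance matrix of a Gaussian state with zero first moments by $V\mapsto\tau V+\nu I$ (the vacuum having covariance matrix $\tfrac12 I$). A pattern is a string $\boldsymbol i=(i_1,\dots,i_m)\in\{B,T\}^m$; the $u$-CPF (channel position finding) image space $\mathcal U^u$ is the set of patterns with exactly $u$ entries equal to $T$, and $d_h$ is the Hamming distance. A $k$-LNN (local nearest neighbour) protocol assigns to each channel $i\in\{1,\dots,m\}$ a set $\mathcal N(i)\not\ni i$ of exactly $k$ neighbours, with $j\in\mathcal N(i)\iff i\in\mathcal N(j)$; its set of probe domains is $\mathcal S=\bigcup_{i}\bigcup_{j\in\mathcal N(i)}\{\{i,j\}\}$. One two-mode squeezed vacuum (TMSV) state $\varphi_\mu$, i.e. the two-mode Gaussian state with zero first moments and covariance matrix $\begin{pmatrix}\mu I&\Gamma\\ \Gamma&\mu I\end{pmatrix}$, $\Gamma=\mathrm{diag}(c,-c)$,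 $c=\sqrt{\mu^2-1/4}$, $\mu\ge\tfrac12$, is used for each probe domain, so the probe state is $\boldsymbol\varphi_\mu=\bigotimes_{\boldsymbol s\in\mathcal S}\varphi_\mu$, and a pattern $\boldsymbol i$ is mapped to the modified pattern $\boldsymbol\nu_{\boldsymbol i}=\biguplus_{\boldsymbol s\in\mathcal S}\{i_j\}_{j\in\boldsymbol s}$, with multi-channel $\mathcal E_{\boldsymbol\nu_{\boldsymbol i}}=\bigotimes_{\boldsymbol s\in\mathcal S}\bigotimes_{j\in\boldsymbol s}\mathcal E_{i_j}$. For every $k$-LNN protocol with $k=k_{\max}=m-1$ (read as $k=0$ if $m=0$): 1. the probe domains are exactly the two-element subsets of $\{1,\dots,m\}$, so that every pair of channels is probed by a TMSV state; 2. the modified patterns have length $m(m-1)$; 3. there is a function $(u,v,d)\mapsto F_{[u:v|d]}\in\mathbb R$ such that, for all $u,v,d\in\mathbb N$ and all subsets $\mathcal X\subseteq\mathcal U^u$, $\mathcal Y\subseteq\mathcal U^v$ with $d_h(\boldsymbol i,\boldsymbol i')=d$ for all $\boldsymbol i\in\mathcal X$, $\boldsymbol i'\in\mathcal Y$, $$F\big(\mathcal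 E_{\boldsymbol\nu_{\boldsymbol i}}(\boldsymbol\varphi_\mu),\,\mathcal E_{\boldsymbol\nu_{\boldsymbol i'}}(\boldsymbol\varphi_\mu)\big)=F_{[u:v|d]}\qquad\text{for all }\boldsymbol i\in\mathcal X,\ \boldsymbol i'\in\mathcal Y,$$ where $F(\rho,\sigma)=\mathrm{Tr}\sqrt{\sqrt\rho\,\sigma\sqrt\rho}$ is the Bures fidelity. That is, the output fidelity depends on the pair of patterns only through $(u,v,d)$. -/

import Mathlib

open MeasureTheory

noncomputable section

namespace BosonicPattern

/-! ### Trace and fidelity -/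

section Trace

variable {H : Type} [NormedAddCommGroup H] [InnerProductSpace ℂ H] [CompleteSpace H]

/-- `A` has trace `t`: the diagonal of `A` is (unconditionally) summable to `t` in every
Hilbert basis. The operators that have a trace are exactly the trace-class ones. -/
def HasTrace (A : H →L[ℂ] H) (t : ℂ) : Prop :=
  ∀ (κ : Type) (b : HilbertBasis κ ℂ H),
    HasSum (fun k => inner ℂ (b k) (A (b k))) t

open scoped Classical in
/-- The trace of a trace-class operator. -/
def trace (A : H →L[ℂ] H) : ℂ :=
  if h : ∃ t, HasTrace A t then h.choose else 0

/-- The Bures fidelity `F(ρ, σ) = Tr √(√ρ σ √ρ)`. -/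
def fidelity (ρ σ : H →L[ℂ] H) : ℝ :=
  (trace (CFC.sqrt (CFC.sqrt ρ * σ * CFC.sqrt ρ))).re

end Trace

/-! ### Bosonic modes, Weyl operators and Gaussian states -/

/-- The Hilbert space `L²(ℝ^ι)` of a system of bosonic modes labelled by `ι`
(position representation). -/
abbrev ModeSpace (ι : Type) [Fintype ι] : Type :=
  Lp ℂ 2 (volume : Measure (ι → ℝ))

/-- Phase-space vectors: `ξ (k, 0)` and `ξ (k, 1)` are the coefficients of the position `x_k` and
the momentum `p_k` of mode `k`. -/
abbrev PhaseSpace (ι : Type) : Type := ι × Fin 2 → ℝ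

variable {ι : Type} [Fintype ι]

/-- The phase of the Weyl operator at the point `x`. -/
def weylPhase (ξ : PhaseSpace ι) (x : ι → ℝ) : ℂ :=
  Complex.exp (((∑ k, ξ (k, 0) * (x k + ξ (k, 1) / 2) : ℝ) : ℂ) * Complex.I)

theorem norm_weylPhase (ξ : PhaseSpace ι) (x : ι → ℝ) : ‖weylPhase ξ x‖ = 1 :=
  Complex.norm_exp_ofReal_mul_I _

theorem continuous_weylPhase (ξ : PhaseSpace ι) : Continuous (weylPhase ξ) := by
  unfold weylPhase
  fun_prop

/-- Translation `ψ ↦ ψ(· + t)`. -/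
def translation (t : ι → ℝ) : ModeSpace ι →ₗᵢ[ℂ] ModeSpace ι :=
  Lp.compMeasurePreservingₗᵢ ℂ (fun x => x + t) (measurePreserving_add_right volume t)

theorem memLp_weylPhase_mul (ξ : PhaseSpace ι) (ψ : ModeSpace ι) :
    MemLp (fun x => weylPhase ξ x * ψ x) 2 (volume : Measure (ι → ℝ)) :=
  (Lp.memLp ψ).of_le
    ((continuous_weylPhase ξ).aestronglyMeasurable.mul (Lp.aestronglyMeasurable ψ))
    (Filter.Eventually.of_forall fun x => by simp [norm_weylPhase])

/-- Multiplication by the phase of a Weyl operator. -/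
def phaseMul (ξ : PhaseSpace ι) : ModeSpace ι →ₗᵢ[ℂ] ModeSpace ι where
  toFun ψ := (memLp_weylPhase_mul ξ ψ).toLp _
  map_add' ψ φ := by
    rw [← MemLp.toLp_add]
    apply MemLp.toLp_congr
    filter_upwards [Lp.coeFn_add ψ φ] with x hx
    simp only [hx, Pi.add_apply, mul_add]
  map_smul' c ψ := by
    rw [RingHom.id_apply, ← MemLp.toLp_const_smul]
    apply MemLp.toLp_congr
    filter_upwards [Lp.coeFn_smul c ψ] with x hx
    simp [hx, mul_left_comm]
  norm_map' ψ := by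
    apply le_antisymm
    · apply Lp.norm_le_norm_of_ae_le
      filter_upwards [(memLp_weylPhase_mul ξ ψ).coeFn_toLp] with x hx
      simp only [LinearMap.coe_mk, AddHom.coe_mk]
      rw [hx, norm_mul, norm_weylPhase, one_mul]
    · apply Lp.norm_le_norm_of_ae_le
      filter_upwards [(memLp_weylPhase_mul ξ ψ).coeFn_toLp] with x hx
      simp only [LinearMap.coe_mk, AddHom.coe_mk]
      rw [hx, norm_mul, norm_weylPhase, one_mul]

/-- The Weyl operator `W(ξ) = exp(i ∑ₖ (ξ_{k,0} x_k + ξ_{k,1} p_k))`, with `[x_k, p_l] = i δ_{kl}`: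
`(W(ξ) ψ)(x) = exp(i ∑ₖ ξ_{k,0} (x_k + ξ_{k,1} / 2)) ψ(x + ξ_{·,1})`. -/
def weyl (ξ : PhaseSpace ι) : ModeSpace ι →L[ℂ] ModeSpace ι :=
  (phaseMul ξ).toContinuousLinearMap ∘L
    (translation fun k => ξ (k, 1)).toContinuousLinearMap

/-- The quantum characteristic function `χ_A(ξ) = Tr (A W(ξ))`. -/
def charFn (A : ModeSpace ι →L[ℂ] ModeSpace ι) (ξ : PhaseSpace ι) : ℂ :=
  trace (A * weyl ξ)

open scoped Classical in
/-- The operator with characteristic function `χ`, through the Fourier-Weyl relation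
`A = (2π)⁻ⁿ ∫ χ(ξ) W(-ξ) dξ`, the integral over the `2n`-dimensional phase space being taken in
the weak sense. (The weak integral exists, and is a bounded operator, for every
square-integrable `χ`, in particular for every characteristic function of a trace-class
operator.) -/
def ofCharFn (χ : PhaseSpace ι → ℂ) : ModeSpace ι →L[ℂ] ModeSpace ι :=
  if h : ∃ A : ModeSpace ι →L[ℂ] ModeSpace ι, ∀ f g : ModeSpace ι,
      inner ℂ f (A g) = ((2 * (Real.pi : ℂ)) ^ Fintype.card ι)⁻¹ *
        ∫ ξ : PhaseSpace ι, χ ξ * inner ℂ f (weyl (-ξ) g)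
  then h.choose else 0

/-- The Gaussian state with zero first moments and covariance matrix `V`
(the vacuum has covariance matrix `1/2`): `χ(ξ) = exp(-ξᵀ V ξ / 2)`. -/
def gaussianState (V : Matrix (ι × Fin 2) (ι × Fin 2) ℝ) : ModeSpace ι →L[ℂ] ModeSpace ι :=
  ofCharFn fun ξ => ((Real.exp (-(ξ ⬝ᵥ V.mulVec ξ) / 2) : ℝ) : ℂ)

/-! ### Gaussian phase-insensitive channels -/

/-- A single-mode Gaussian phase-insensitive channel: transmissivity `τ ≥ 0` and induced noise `ν`,
subject to the complete-positivity condition `ν ≥ |1 - τ| / 2`. -/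
structure GPIChannel where
  /-- transmissivity -/
  τ : ℝ
  /-- induced noise -/
  ν : ℝ
  τ_nonneg : 0 ≤ τ
  noise_ge : |1 - τ| / 2 ≤ ν

/-- The multi-channel `⨂ₖ E k` acting on operators:
`χ_out(ξ) = χ_in(√τ ξ) exp(-∑ₖ ν_k |ξ_k|² / 2)`. On a Gaussian state with zero first moments and
covariance matrix `V` it acts by `V ↦ (⨁ₖ √τ_k I) V (⨁ₖ √τ_k I)ᵀ + ⨁ₖ ν_k I`. -/
def multiChannel (E : ι → GPIChannel) (A : ModeSpace ι →L[ℂ] ModeSpace ι) :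
    ModeSpace ι →L[ℂ] ModeSpace ι :=
  ofCharFn fun ξ => charFn A (fun q => √(E q.1).τ * ξ q) *
    ((Real.exp (-(∑ q : ι × Fin 2, (E q.1).ν * ξ q ^ 2) / 2) : ℝ) : ℂ)

/-! ### Channel patterns -/

/-- A binary channel pattern of length `|ι|`: `false` is a background channel,
`true` a target channel. -/
abbrev Pattern (ι : Type) : Type := ι → Bool

/-- The `u`-CPF image space: the patterns of length `m` with exactly `u` target channels. -/
def cpfImageSpace (m u : ℕ) : Set (Pattern (Fin m)) :=
  {i | (Finset.univ.filter fun j => i j = true).card = u}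

/-- The multi-channel of a pattern, for given background and target channels. -/
def patternChannel (EB ET : GPIChannel) (i : Pattern ι) :
    (ModeSpace ι →L[ℂ] ModeSpace ι) → (ModeSpace ι →L[ℂ] ModeSpace ι) :=
  multiChannel fun k => if i k then ET else EB

/-! ### `k`-local-nearest-neighbour protocols -/

/-- A `k`-LNN protocol on `m` channels: a neighbourhood function for which every channel
is probed in conjunction with exactly `k` other channels. -/
structure LNNProtocol (m k : ℕ) where
  /-- the neighbourhood function -/
  nbhd : Fin m → Finset (Fin m)
  not_mem_self : ∀ i, i ∉ nbhd i
  symm : ∀ i j, j ∈ nbhd i → i ∈ nbhd j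
  card_nbhd : ∀ i, (nbhd i).card = k

/-- The probe-domain distribution `⋃ᵢ ⋃_{j ∈ N(i)} {{i, j}}`. -/
def LNNProtocol.domains {m k : ℕ} (P : LNNProtocol m k) : Finset (Finset (Fin m)) :=
  Finset.univ.biUnion fun i => (P.nbhd i).image fun j => {i, j}

/-- The positions of the modified pattern of a probe-domain distribution `S`: pairs of a domain
`s ∈ S` and a channel `j ∈ s`. -/
abbrev ModifiedIndex {m : ℕ} (S : Finset (Finset (Fin m))) : Type :=
  Σ s : {s // s ∈ S}, {j // j ∈ s.1}

/-- The modified pattern `ν_i = ⨄_{s ∈ S} {i_j}_{j ∈ s}`. -/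
def modifiedPattern {m : ℕ} (S : Finset (Finset (Fin m))) (i : Pattern (Fin m)) :
    Pattern (ModifiedIndex S) :=
  fun q => i q.2.1

/-- The covariance matrix of a two-mode squeezed vacuum state whose two modes are labelled by
the two-element type `κ`: `μ I` on the diagonal blocks and `diag(c, -c)`,
`c = √(μ² - 1/4)`, on the off-diagonal blocks. -/
def tmsvCM (κ : Type) [DecidableEq κ] (μ : ℝ) : Matrix (κ × Fin 2) (κ × Fin 2) ℝ :=
  Matrix.of fun p q =>
    if p.2 = q.2 then
      if p.1 = q.1 then μ
      else if p.2 = 0 then √(μ ^ 2 - 1 / 4) else -√(μ ^ 2 - 1 / 4)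
    else 0

/-- The covariance matrix `⨁_{s ∈ S}` of the product of one TMSV state per probe domain. -/
def probeCM {m : ℕ} (S : Finset (Finset (Fin m))) (μ : ℝ) :
    Matrix (ModifiedIndex S × Fin 2) (ModifiedIndex S × Fin 2) ℝ :=
  (Matrix.blockDiagonal' fun s : {s // s ∈ S} => tmsvCM {j // j ∈ s.1} μ).submatrix
    (Equiv.sigmaProdDistrib _ _) (Equiv.sigmaProdDistrib _ _)

/-- The probe state of the protocol: the product of one TMSV state per probe domain. -/
def probeState {m : ℕ} (S : Finset (Finset (Fin m))) (μ : ℝ) :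
    ModeSpace (ModifiedIndex S) →L[ℂ] ModeSpace (ModifiedIndex S) :=
  gaussianState (probeCM S μ)

/-- The output state when the probe state is irradiated over the modified pattern of `i`. -/
def outputState {m : ℕ} (EB ET : GPIChannel) (μ : ℝ) (S : Finset (Finset (Fin m)))
    (i : Pattern (Fin m)) :
    ModeSpace (ModifiedIndex S) →L[ℂ] ModeSpace (ModifiedIndex S) :=
  patternChannel EB ET (modifiedPattern S i) (probeState S μ)

end BosonicPattern

end

/-!
The proof is by symmetry. When every pair of channels is a probe domain, a permutation `π` of the
channels maps probe domains to probe domains, and so it permutes the modes of the probe state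
(`domainPerm`). All modes of all TMSV states are prepared alike, so the covariance matrix of the
probe state does not change under this permutation (`probeCM_domainPerm`).

A permutation `e` of the modes acts on `L²(ℝ^ι)` by the unitary `modeRelabel e`, `ψ ↦ ψ(· ∘ e)`,
and conjugation by it turns `W(ξ ∘ e)` into `W(ξ)` (`conj_weyl`). Traces, and hence characteristic
functions, Gaussian states and multi-channels, are covariant under this conjugation, so that the
output state of the pattern `i` is the conjugate of the output state of `i ∘ π`
(`outputState_comp_perm`). As the fidelity is unitarily invariant (`fidelity_conj`), the pairs
`(i, i')` and `(i ∘ π, i' ∘ π)` have the same output fidelity.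

Finally, two pairs of patterns of the same length with the same numbers of target channels and the
same Hamming distance differ by such a permutation (`exists_perm_of_hammingDist_eq`): these data
determine how many positions carry each of the four combinations of background and target.
-/

open MeasureTheory

noncomputable section

namespace BosonicPattern

/-! ### Unitary invariance of the trace and of the fidelity -/

section Unitary

variable {H : Type} [NormedAddCommGroup H] [InnerProductSpace ℂ H] [CompleteSpace H]

theorem HasTrace.conj {A : H →L[ℂ] H} {t : ℂ} (h : HasTrace A t) (U : H ≃ₗᵢ[ℂ] H) :
    HasTrace (U.conjStarAlgEquiv A) t := by
  intro κ b
  have hb : ∀ k, (HilbertBasis.ofRepr (U.trans b.repr)) k = U.symm (b k) := by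
    classical
    intro k
    rw [← HilbertBasis.repr_symm_single, ← HilbertBasis.repr_symm_single]
    rfl
  convert h κ (HilbertBasis.ofRepr (U.trans b.repr)) using 2 with k
  rw [hb, LinearIsometryEquiv.conjStarAlgEquiv_apply_apply, LinearIsometryEquiv.inner_map_eq_flip,
    LinearIsometryEquiv.symm_symm]

theorem hasTrace_conj_iff (U : H ≃ₗᵢ[ℂ] H) (A : H →L[ℂ] H) (t : ℂ) :
    HasTrace (U.conjStarAlgEquiv A) t ↔ HasTrace A t := by
  refine ⟨fun h => ?_, fun h => h.conj U⟩
  have h' := h.conj U.symm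
  rwa [← LinearIsometryEquiv.symm_conjStarAlgEquiv, StarAlgEquiv.symm_apply_apply] at h'

theorem trace_conj (U : H ≃ₗᵢ[ℂ] H) (A : H →L[ℂ] H) :
    trace (U.conjStarAlgEquiv A) = trace A := by
  unfold trace
  have h : HasTrace (U.conjStarAlgEquiv A) = HasTrace A :=
    funext fun t => propext (hasTrace_conj_iff U A t)
  rw [h]

theorem conj_nonneg_iff (U : H ≃ₗᵢ[ℂ] H) (A : H →L[ℂ] H) :
    0 ≤ U.conjStarAlgEquiv A ↔ 0 ≤ A := by
  refine ⟨fun h => ?_, fun h => map_nonneg _ h⟩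
  have h' := map_nonneg U.conjStarAlgEquiv.symm h
  rwa [StarAlgEquiv.symm_apply_apply] at h'

theorem sqrt_conj (U : H ≃ₗᵢ[ℂ] H) (A : H →L[ℂ] H) :
    CFC.sqrt (U.conjStarAlgEquiv A) = U.conjStarAlgEquiv (CFC.sqrt A) := by
  by_cases hA : 0 ≤ A
  · refine CFC.sqrt_unique ?_ ((conj_nonneg_iff U _).2 (CFC.sqrt_nonneg A))
    rw [← map_mul, CFC.sqrt_mul_sqrt_self A hA]
  · -- The square root of an operator that is not positive is `0` by convention.
    rw [CFC.sqrt_of_not_nonneg hA, CFC.sqrt_of_not_nonneg (mt (conj_nonneg_iff U A).1 hA), map_zero]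

theorem fidelity_conj (U : H ≃ₗᵢ[ℂ] H) (ρ σ : H →L[ℂ] H) :
    fidelity (U.conjStarAlgEquiv ρ) (U.conjStarAlgEquiv σ) = fidelity ρ σ := by
  unfold fidelity
  rw [sqrt_conj, ← map_mul, ← map_mul, sqrt_conj, trace_conj]

end Unitary

/-! ### Permutations of the modes -/

section Relabel

variable {ι : Type} [Fintype ι]

theorem coe_piCongrLeft_symm_perm {α : Type} (e : Equiv.Perm α) :
    ⇑(MeasurableEquiv.piCongrLeft (fun _ : α => ℝ) e.symm) = fun x => x ∘ e := by
  ext x k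
  obtain ⟨k, rfl⟩ := e.symm.surjective k
  rw [MeasurableEquiv.coe_piCongrLeft, Equiv.piCongrLeft_apply_apply]
  simp

theorem measurePreserving_comp_perm (e : Equiv.Perm ι) :
    MeasurePreserving (fun x : ι → ℝ => x ∘ e) volume volume :=
  coe_piCongrLeft_symm_perm e ▸ volume_measurePreserving_piCongrLeft (fun _ : ι => ℝ) e.symm

theorem measurableEmbedding_comp_perm {α : Type} (e : Equiv.Perm α) :
    MeasurableEmbedding (fun x : α → ℝ => x ∘ e) :=
  coe_piCongrLeft_symm_perm e ▸ MeasurableEquiv.measurableEmbedding _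

/-- The unitary on `L²(ℝ^ι)` that permutes the modes: `ψ ↦ ψ(· ∘ e)`. -/
def modeRelabel (e : Equiv.Perm ι) : ModeSpace ι ≃ₗᵢ[ℂ] ModeSpace ι :=
  LinearIsometryEquiv.ofSurjective
    (Lp.compMeasurePreservingₗᵢ ℂ (fun x => x ∘ e) (measurePreserving_comp_perm e)) fun ψ => by
      refine ⟨Lp.compMeasurePreserving _ (measurePreserving_comp_perm e.symm) ψ, ?_⟩
      apply Lp.ext
      refine (Lp.coeFn_compMeasurePreserving _ (measurePreserving_comp_perm e)).trans ?_
      filter_upwards [(measurePreserving_comp_perm e).quasiMeasurePreserving.ae_eq_comp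
        (Lp.coeFn_compMeasurePreserving ψ (measurePreserving_comp_perm e.symm))] with x hx
      rw [hx]
      simp [Function.comp_assoc]

theorem coeFn_modeRelabel (e : Equiv.Perm ι) (ψ : ModeSpace ι) :
    modeRelabel e ψ =ᵐ[volume] fun x => ψ (x ∘ e) :=
  Lp.coeFn_compMeasurePreserving ψ (measurePreserving_comp_perm e)

theorem coeFn_weyl (ξ : PhaseSpace ι) (ψ : ModeSpace ι) :
    weyl ξ ψ =ᵐ[volume] fun x => weylPhase ξ x * ψ (x + fun k => ξ (k, 1)) := by
  refine (memLp_weylPhase_mul ξ (translation (fun k => ξ (k, 1)) ψ)).coeFn_toLp.trans ?_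
  filter_upwards [Lp.coeFn_compMeasurePreserving ψ
    (measurePreserving_add_right volume (fun k => ξ (k, 1)))] with x hx
  exact congrArg _ hx

/-- The permutation of the coordinates of phase space that is induced by a permutation of the
modes. -/
abbrev phasePerm (e : Equiv.Perm ι) : Equiv.Perm (ι × Fin 2) :=
  Equiv.prodCongr e (Equiv.refl (Fin 2))

theorem weylPhase_comp_perm (e : Equiv.Perm ι) (ξ : PhaseSpace ι) (x : ι → ℝ) :
    weylPhase (ξ ∘ phasePerm e) (x ∘ e) = weylPhase ξ x := by
  unfold weylPhase
  rw [← Equiv.sum_comp e fun k => ξ (k, 0) * (x k + ξ (k, 1) / 2)]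
  rfl

theorem weyl_modeRelabel (e : Equiv.Perm ι) (ξ : PhaseSpace ι) (ψ : ModeSpace ι) :
    weyl ξ (modeRelabel e ψ) = modeRelabel e (weyl (ξ ∘ phasePerm e) ψ) := by
  apply Lp.ext
  filter_upwards [coeFn_weyl ξ (modeRelabel e ψ),
    coeFn_modeRelabel e (weyl (ξ ∘ phasePerm e) ψ),
    (measurePreserving_add_right volume fun k => ξ (k, 1)).quasiMeasurePreserving.ae_eq_comp
      (coeFn_modeRelabel e ψ),
    (measurePreserving_comp_perm e).quasiMeasurePreserving.ae_eq_comp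
      (coeFn_weyl (ξ ∘ phasePerm e) ψ)] with x h₁ h₂ h₃ h₄
  simp only [Function.comp_apply] at h₃ h₄
  rw [h₁, h₂, h₃, h₄, weylPhase_comp_perm]
  rfl

theorem conj_weyl (e : Equiv.Perm ι) (ξ : PhaseSpace ι) :
    (modeRelabel e).conjStarAlgEquiv (weyl (ξ ∘ phasePerm e)) = weyl ξ := by
  ext1 ψ
  rw [LinearIsometryEquiv.conjStarAlgEquiv_apply_apply, ← weyl_modeRelabel,
    LinearIsometryEquiv.apply_symm_apply]

theorem charFn_conj (e : Equiv.Perm ι) (A : ModeSpace ι →L[ℂ] ModeSpace ι) (ξ : PhaseSpace ι) :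
    charFn ((modeRelabel e).conjStarAlgEquiv A) ξ = charFn A (ξ ∘ phasePerm e) := by
  unfold charFn
  rw [← conj_weyl e ξ, ← map_mul, trace_conj]

/-- The Fourier-Weyl relation determines the operator. -/
theorem ofCharFn_eq {χ : PhaseSpace ι → ℂ} {A : ModeSpace ι →L[ℂ] ModeSpace ι}
    (hA : ∀ f g : ModeSpace ι, inner ℂ f (A g) = ((2 * (Real.pi : ℂ)) ^ Fintype.card ι)⁻¹ *
      ∫ ξ : PhaseSpace ι, χ ξ * inner ℂ f (weyl (-ξ) g)) :
    ofCharFn χ = A := by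
  have h : ∃ A : ModeSpace ι →L[ℂ] ModeSpace ι, ∀ f g : ModeSpace ι,
      inner ℂ f (A g) = ((2 * (Real.pi : ℂ)) ^ Fintype.card ι)⁻¹ *
        ∫ ξ : PhaseSpace ι, χ ξ * inner ℂ f (weyl (-ξ) g) := ⟨A, hA⟩
  rw [ofCharFn, dif_pos h]
  ext1 g
  exact ext_inner_left ℂ fun f => (h.choose_spec f g).trans (hA f g).symm

theorem fourierWeyl_conj (e : Equiv.Perm ι) {χ : PhaseSpace ι → ℂ}
    {A : ModeSpace ι →L[ℂ] ModeSpace ι}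
    (hA : ∀ f g : ModeSpace ι, inner ℂ f (A g) = ((2 * (Real.pi : ℂ)) ^ Fintype.card ι)⁻¹ *
      ∫ ξ : PhaseSpace ι, χ ξ * inner ℂ f (weyl (-ξ) g)) (f g : ModeSpace ι) :
    inner ℂ f ((modeRelabel e).conjStarAlgEquiv A g) =
      ((2 * (Real.pi : ℂ)) ^ Fintype.card ι)⁻¹ *
        ∫ ξ : PhaseSpace ι, χ (ξ ∘ phasePerm e) * inner ℂ f (weyl (-ξ) g) := by
  have hf : inner ℂ f ((modeRelabel e).conjStarAlgEquiv A g) =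
      inner ℂ ((modeRelabel e).symm f) (A ((modeRelabel e).symm g)) := by
    rw [LinearIsometryEquiv.inner_map_eq_flip, LinearIsometryEquiv.symm_symm]
    rfl
  rw [hf, hA, ← (measurePreserving_comp_perm (phasePerm e)).integral_comp
    (measurableEmbedding_comp_perm (phasePerm e))]
  congr! 4 with ξ
  rw [LinearIsometryEquiv.inner_map_eq_flip, LinearIsometryEquiv.symm_symm, ← conj_weyl e (-ξ)]
  rfl

/-- Permuting the arguments of a characteristic function conjugates its operator. This holds
whether or not the weak integral exists. -/
theorem ofCharFn_comp_perm (e : Equiv.Perm ι) (χ : PhaseSpace ι → ℂ) :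
    ofCharFn (fun ξ => χ (ξ ∘ phasePerm e)) = (modeRelabel e).conjStarAlgEquiv (ofCharFn χ) := by
  by_cases h : ∃ A : ModeSpace ι →L[ℂ] ModeSpace ι, ∀ f g : ModeSpace ι,
      inner ℂ f (A g) = ((2 * (Real.pi : ℂ)) ^ Fintype.card ι)⁻¹ *
        ∫ ξ : PhaseSpace ι, χ ξ * inner ℂ f (weyl (-ξ) g)
  · obtain ⟨A, hA⟩ := h
    rw [ofCharFn_eq hA]
    exact ofCharFn_eq (fourierWeyl_conj e hA)
  · have h' : ¬ ∃ A : ModeSpace ι →L[ℂ] ModeSpace ι, ∀ f g : ModeSpace ι,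
        inner ℂ f (A g) = ((2 * (Real.pi : ℂ)) ^ Fintype.card ι)⁻¹ *
          ∫ ξ : PhaseSpace ι, χ (ξ ∘ phasePerm e) * inner ℂ f (weyl (-ξ) g) := by
      rintro ⟨A, hA⟩
      refine h ⟨_, fun f g => (fourierWeyl_conj e.symm hA f g).trans ?_⟩
      congr! 5 with ξ
      ext q
      exact congrArg ξ ((phasePerm e).symm_apply_apply q)
    rw [ofCharFn, ofCharFn, dif_neg h, dif_neg h', map_zero]

theorem gaussianState_conj (e : Equiv.Perm ι) {V : Matrix (ι × Fin 2) (ι × Fin 2) ℝ}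
    (hV : ∀ p q, V (phasePerm e p) (phasePerm e q) = V p q) :
    (modeRelabel e).conjStarAlgEquiv (gaussianState V) = gaussianState V := by
  unfold gaussianState
  rw [← ofCharFn_comp_perm]
  congr! 6 with ξ
  have hVe : V.submatrix (phasePerm e) (phasePerm e) = V := by
    ext p q
    exact hV p q
  conv_lhs => rw [← hVe]
  rw [Matrix.submatrix_mulVec_equiv, Function.comp_assoc, Equiv.self_comp_symm,
    Function.comp_id, comp_equiv_dotProduct_comp_equiv]

theorem multiChannel_conj (e : Equiv.Perm ι) (E : ι → GPIChannel)
    (A : ModeSpace ι →L[ℂ] ModeSpace ι) :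
    multiChannel E ((modeRelabel e).conjStarAlgEquiv A) =
      (modeRelabel e).conjStarAlgEquiv (multiChannel (E ∘ e) A) := by
  unfold multiChannel
  rw [← ofCharFn_comp_perm]
  congr 1
  ext1 ξ
  rw [charFn_conj, ← Equiv.sum_comp (phasePerm e)]
  rfl

theorem patternChannel_conj (e : Equiv.Perm ι) (EB ET : GPIChannel) (i : Pattern ι)
    (A : ModeSpace ι →L[ℂ] ModeSpace ι) :
    patternChannel EB ET i ((modeRelabel e).conjStarAlgEquiv A) =
      (modeRelabel e).conjStarAlgEquiv (patternChannel EB ET (i ∘ e) A) :=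
  multiChannel_conj e _ A

end Relabel

/-! ### Permutations of the channels -/

section Channels

variable {m : ℕ} {S : Finset (Finset (Fin m))} {π : Equiv.Perm (Fin m)}

/-- The permutation `(s, j) ↦ (π s, π j)` of the positions of the modified pattern that is induced
by a permutation `π` of the channels mapping domains to domains. -/
def domainPerm (hS : ∀ s ∈ S, s.map π.toEmbedding ∈ S) : Equiv.Perm (ModifiedIndex S) :=
  Equiv.ofBijective
    (fun q => ⟨⟨q.1.1.map π.toEmbedding, hS _ q.1.2⟩, ⟨π q.2.1, by simp [q.2.2]⟩⟩) <| by
    refine Finite.injective_iff_bijective.1 ?_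
    rintro ⟨⟨s, hs⟩, ⟨j, hj⟩⟩ ⟨⟨s', hs'⟩, ⟨j', hj'⟩⟩ h
    simp only [Sigma.mk.injEq, Subtype.mk.injEq, Finset.map_inj] at h
    obtain ⟨rfl, h⟩ := h
    simpa using h

theorem domainPerm_fst (hS : ∀ s ∈ S, s.map π.toEmbedding ∈ S) (q : ModifiedIndex S) :
    (domainPerm hS q).1.1 = q.1.1.map π.toEmbedding := rfl

theorem domainPerm_snd (hS : ∀ s ∈ S, s.map π.toEmbedding ∈ S) (q : ModifiedIndex S) :
    (domainPerm hS q).2.1 = π q.2.1 := rfl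

theorem probeCM_apply (S : Finset (Finset (Fin m))) (μ : ℝ) (p q : ModifiedIndex S × Fin 2) :
    probeCM S μ p q =
      if p.1.1.1 = q.1.1.1 ∧ p.2 = q.2 then
        if p.1.2.1 = q.1.2.1 then μ
        else if p.2 = 0 then √(μ ^ 2 - 1 / 4) else -√(μ ^ 2 - 1 / 4)
      else 0 := by
  obtain ⟨⟨⟨s, hs⟩, ⟨j, hj⟩⟩, a⟩ := p
  obtain ⟨⟨⟨s', hs'⟩, ⟨j', hj'⟩⟩, a'⟩ := q
  by_cases h : s = s'
  · subst h
    simp [probeCM, Equiv.sigmaProdDistrib, Matrix.blockDiagonal'_apply, tmsvCM]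
  · simp [probeCM, Equiv.sigmaProdDistrib, Matrix.blockDiagonal'_apply, h]

theorem probeCM_domainPerm (hS : ∀ s ∈ S, s.map π.toEmbedding ∈ S) (μ : ℝ)
    (p q : ModifiedIndex S × Fin 2) :
    probeCM S μ (phasePerm (domainPerm hS) p) (phasePerm (domainPerm hS) q) = probeCM S μ p q := by
  simp [probeCM_apply, domainPerm_fst, domainPerm_snd]

theorem outputState_comp_perm (EB ET : GPIChannel) (μ : ℝ)
    (hS : ∀ s ∈ S, s.map π.toEmbedding ∈ S) (i : Pattern (Fin m)) :
    (modeRelabel (domainPerm hS)).conjStarAlgEquiv (outputState EB ET μ S (i ∘ π)) =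
      outputState EB ET μ S i := by
  have hi : modifiedPattern S (i ∘ π) = modifiedPattern S i ∘ domainPerm hS := rfl
  rw [outputState, hi, ← patternChannel_conj, probeState,
    gaussianState_conj _ (probeCM_domainPerm hS μ)]
  rfl

theorem fidelity_outputState_comp_perm (EB ET : GPIChannel) (μ : ℝ)
    (hS : ∀ s ∈ S, s.map π.toEmbedding ∈ S) (i i' : Pattern (Fin m)) :
    fidelity (outputState EB ET μ S (i ∘ π)) (outputState EB ET μ S (i' ∘ π)) =
      fidelity (outputState EB ET μ S i) (outputState EB ET μ S i') := by
  rw [← fidelity_conj (modeRelabel (domainPerm hS)), outputState_comp_perm, outputState_comp_perm]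

end Channels

/-! ### Pairs of patterns up to permutation -/

theorem exists_perm_comp_eq {α γ : Type} [Fintype α] [DecidableEq γ] {f g : α → γ}
    (h : ∀ c, (Finset.univ.filter fun a => f a = c).card =
      (Finset.univ.filter fun a => g a = c).card) :
    ∃ π : Equiv.Perm α, g ∘ π = f := by
  have e : ∀ c, Nonempty ({a // f a = c} ≃ {a // g a = c}) := fun c =>
    Fintype.card_eq.1 (by rw [Fintype.card_subtype, Fintype.card_subtype, h])
  exact ⟨Equiv.ofFiberEquiv fun c => (e c).some, funext fun a => Equiv.ofFiberEquiv_map _ a⟩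

/-- Linear equations that determine the numbers of positions with each of the four combinations of
entries of two patterns from the length, the weights and the Hamming distance. -/
theorem card_filter_pair {m u v : ℕ} {i i' : Pattern (Fin m)} (hi : i ∈ cpfImageSpace m u)
    (hi' : i' ∈ cpfImageSpace m v) :
    let n := fun c : Bool × Bool => (Finset.univ.filter fun a => (i a, i' a) = c).card
    n (true, true) + n (true, false) = u ∧ n (true, true) + n (false, true) = v ∧
      n (true, false) + n (false, true) = hammingDist i i' ∧
      n (true, true) + n (true, false) + n (false, true) + n (false, false) = m := by
  have hm : ∑ _a : Fin m, 1 = m := by simp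
  rw [cpfImageSpace, Set.mem_ofPred_eq] at hi hi'
  subst hi hi'
  simp only [hammingDist]
  refine ⟨?_, ?_, ?_, Eq.trans ?_ hm⟩ <;>
  · simp only [Finset.card_filter, ← Finset.sum_add_distrib]
    refine Finset.sum_congr rfl fun a _ => ?_
    cases i a <;> cases i' a <;> rfl

theorem exists_perm_of_hammingDist_eq {m u v : ℕ} {i i' j j' : Pattern (Fin m)}
    (hi : i ∈ cpfImageSpace m u) (hi' : i' ∈ cpfImageSpace m v)
    (hj : j ∈ cpfImageSpace m u) (hj' : j' ∈ cpfImageSpace m v)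
    (hd : hammingDist i i' = hammingDist j j') :
    ∃ π : Equiv.Perm (Fin m), j ∘ π = i ∧ j' ∘ π = i' := by
  obtain ⟨π, hπ⟩ : ∃ π : Equiv.Perm (Fin m), (fun a => (j a, j' a)) ∘ π = fun a => (i a, i' a) := by
    apply exists_perm_comp_eq
    obtain ⟨h₁, h₂, h₃, h₄⟩ := card_filter_pair hi hi'
    obtain ⟨k₁, k₂, k₃, k₄⟩ := card_filter_pair hj hj'
    dsimp only at h₁ h₂ h₃ h₄ k₁ k₂ k₃ k₄
    rintro ⟨_ | _, _ | _⟩ <;> omega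
  exact ⟨π, funext fun a => congrArg Prod.fst (congrFun hπ a),
    funext fun a => congrArg Prod.snd (congrFun hπ a)⟩

/-! ### Probe domains of the full neighbourhood -/

theorem LNNProtocol.mem_nbhd_iff {m : ℕ} (P : LNNProtocol m (m - 1)) {i j : Fin m} :
    j ∈ P.nbhd i ↔ j ≠ i := by
  have h : P.nbhd i = Finset.univ.erase i := by
    refine Finset.eq_of_subset_of_card_le (fun j hj => ?_) (by simp [P.card_nbhd])
    exact Finset.mem_erase.2 ⟨fun hji => P.not_mem_self i (hji ▸ hj), Finset.mem_univ j⟩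
  simp [h]

theorem LNNProtocol.domains_eq {m : ℕ} (P : LNNProtocol m (m - 1)) :
    P.domains = Finset.powersetCard 2 Finset.univ := by
  ext s
  simp only [LNNProtocol.domains, Finset.mem_biUnion, Finset.mem_univ, true_and, Finset.mem_image,
    P.mem_nbhd_iff, Finset.mem_powersetCard_univ, Finset.card_eq_two]
  exact ⟨fun ⟨i, j, hji, h⟩ => ⟨i, j, hji.symm, h.symm⟩,
    fun ⟨i, j, hij, h⟩ => ⟨i, j, hij.symm, h.symm⟩⟩

theorem card_modifiedIndex {m k : ℕ} {S : Finset (Finset (Fin m))} (hS : ∀ s ∈ S, s.card = k) :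
    Fintype.card (ModifiedIndex S) = S.card * k := by
  rw [Fintype.card_sigma]
  simp only [Fintype.card_coe]
  rw [Finset.sum_coe_sort S Finset.card, Finset.sum_const_nat hS]

end BosonicPattern

end

theorem theorem2 (m : ℕ) (P : BosonicPattern.LNNProtocol m (m - 1))
    (EB ET : BosonicPattern.GPIChannel) (μ : ℝ) (hμ : 1 / 2 ≤ μ) :
    P.domains = Finset.powersetCard 2 Finset.univ ∧
    Fintype.card (BosonicPattern.ModifiedIndex P.domains) = m * (m - 1) ∧
    ∃ F : ℕ → ℕ → ℕ → ℝ, ∀ (u v d : ℕ) (X Y : Set (BosonicPattern.Pattern (Fin m))),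
      X ⊆ BosonicPattern.cpfImageSpace m u → Y ⊆ BosonicPattern.cpfImageSpace m v →
      (∀ i ∈ X, ∀ i' ∈ Y, hammingDist i i' = d) →
      ∀ i ∈ X, ∀ i' ∈ Y,
        BosonicPattern.fidelity
          (BosonicPattern.outputState EB ET μ P.domains i)
          (BosonicPattern.outputState EB ET μ P.domains i') = F u v d := by
  have hcard : ∀ s, s ∈ P.domains ↔ s.card = 2 := fun s => by
    rw [P.domains_eq, Finset.mem_powersetCard_univ]
  refine ⟨P.domains_eq, ?_, ?_⟩
  · rw [BosonicPattern.card_modifiedIndex fun s => (hcard s).1, P.domains_eq,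
      Finset.card_powersetCard, Finset.card_fin, Nat.choose_two_right,
      Nat.div_mul_cancel (Nat.even_mul_pred_self m).two_dvd]
  · classical
    -- `F u v d` is the fidelity of an arbitrary pair of patterns with these data, if there is one.
    let R : ℕ → ℕ → ℕ → BosonicPattern.Pattern (Fin m) × BosonicPattern.Pattern (Fin m) → Prop :=
      fun u v d p => p.1 ∈ BosonicPattern.cpfImageSpace m u ∧
        p.2 ∈ BosonicPattern.cpfImageSpace m v ∧ hammingDist p.1 p.2 = d
    refine ⟨fun u v d => if h : ∃ p, R u v d p then
      BosonicPattern.fidelity (BosonicPattern.outputState EB ET μ P.domains h.choose.1)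
        (BosonicPattern.outputState EB ET μ P.domains h.choose.2) else 0, ?_⟩
    intro u v d X Y hX hY hXY i hi i' hi'
    have h : ∃ p, R u v d p := ⟨(i, i'), hX hi, hY hi', hXY i hi i' hi'⟩
    simp only [dif_pos h]
    obtain ⟨h₁, h₂, h₃⟩ := h.choose_spec
    obtain ⟨π, hπ, hπ'⟩ := BosonicPattern.exists_perm_of_hammingDist_eq (hX hi) (hY hi') h₁ h₂
      ((hXY i hi i' hi').trans h₃.symm)
    rw [← hπ, ← hπ', BosonicPattern.fidelity_outputState_comp_perm EB ET μ fun s hs => ?_]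
    rw [hcard, Finset.card_map]
    exact (hcard s).1 hs
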